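/- Let $A\in\mathbb C^{b\times d}$, $F\in\mathbb C^{e\times d}$ be matrices, let $K_x\in\mathbb C^{d\times d}$ be positive semidefinite, and let $\sigma_B>0$, $\sigma_E\ge 0$, $\tilde\sigma_B\ge 0$. Here $\mathcal N(\mu,K)$ denotes the circularly symmetric complex Gaussian law with mean $\mu$ and covariance $\mathbb E[(w-\mu)(w-\mu)^H]=K$, and $M^\dagger$ the Moore–Penrose pseudo-inverse. For a random vector $x\in\mathbb C^d$ with law $p_x$, let $y=Ax+\omega_B$ and $z=Fx+\omega_E$ with $\omega_B\sim\mathcal N(0,\sigma_B^2I)$ and $\omega_E\sim\mathcal N(0,\sigma_E^2I)$ independent of $x$. An attack is a conditional law $p_{v|z}$ of a vector $v\in\mathbb C^b$ given $z$, with $v$ conditionally independent of $x$ given $z$. The payoff is the Kullback–Leibler divergence $f(p_x,p_{v|z})=\mathbb D(p_{xv}\,\|\,p_{xy})\in[0,\infty]$. The admissible laws $p_x$ are all probability laws on $\mathbb C^d$ with finite second moments and $\mathbb E[xx^H]=K_x$ (in particular all zero-mean laws with covariance $K_x$). Let $p_x^\star=\mathcal N(0,K_x)$, let $G^\star=AK_xF^H(FK_xF^H)^\dagger$,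 suppose that $$\sigma_B^2I-\sigma_E^2\,AK_xF^H\big[(FK_xF^H)^\dagger\big]^2FK_xA^H-\tilde\sigma_B^2I$$ is positive semidefinite, let $C^\star\in\mathbb C^{b\times b}$ be any matrix for which $C^\star C^{\star H}$ equals it, and let $p^\star_{v|z}=\mathcal N(G^\star z,\;C^\star C^{\star H}+\tilde\sigma_B^2I)$. Then $p_x^\star$ is admissible, $f(p_x^\star,p^\star_{v|z})$ is finite, and $(p_x^\star,p^\star_{v|z})$ is a saddle point of $f$, i.e. a Nash equilibrium of the zero-sum game in which the choice of $p_x$ maximizes and the choice of $p_{v|z}$ minimizes $f$. More precisely, $f(p_x,p^\star_{v|z})=f(p_x^\star,p^\star_{v|z})$ for every admissible $p_x$, and $f(p_x^\star,p_{v|z})\ge f(p_x^\star,p^\star_{v|z})$ for every attack $p_{v|z}$. -/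

import Mathlib

open MeasureTheory ProbabilityTheory InformationTheory
open scoped ENNReal NNReal Matrix ComplexOrder MatrixOrder

noncomputable section

namespace Spoofing

/-! ### Moore-Penrose pseudo-inverse -/

section PseudoInverse

variable {m n : Type*} [Fintype m] [Fintype n] [DecidableEq n]

/-- The pseudo-inverse of a Hermitian matrix: each nonzero eigenvalue is inverted in the spectral
decomposition, and the kernel is kept (`0⁻¹ = 0`). -/
def hermPinv {M : Matrix n n ℂ} (hM : M.IsHermitian) : Matrix n n ℂ :=
  (hM.eigenvectorUnitary : Matrix n n ℂ) *
    Matrix.diagonal (fun i => (((hM.eigenvalues i)⁻¹ : ℝ) : ℂ)) *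
    (hM.eigenvectorUnitary : Matrix n n ℂ)ᴴ

/-- The Moore-Penrose pseudo-inverse `M† = (Mᴴ M)† Mᴴ` of a complex matrix. -/
def pinv (M : Matrix m n ℂ) : Matrix n m ℂ :=
  hermPinv (Matrix.isHermitian_conjTranspose_mul_self M) * Mᴴ

/-- The four Penrose equations, which characterize the Moore-Penrose pseudo-inverse. -/
structure IsMoorePenrose (M : Matrix m n ℂ) (P : Matrix n m ℂ) : Prop where
  mul_mul_self : M * P * M = M
  self_mul_mul : P * M * P = P
  left_herm : (M * P)ᴴ = M * P
  right_herm : (P * M)ᴴ = P * M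

theorem hermPinv_spec {M : Matrix n n ℂ} (hM : M.IsHermitian) :
    IsMoorePenrose M (hermPinv hM) ∧ (hermPinv hM)ᴴ = hermPinv hM ∧
      M * hermPinv hM = hermPinv hM * M := by
  set U : Matrix n n ℂ := (hM.eigenvectorUnitary : Matrix n n ℂ) with hU
  have h1 : Uᴴ * U = 1 := Matrix.mem_unitaryGroup_iff'.1 hM.eigenvectorUnitary.2
  set D : Matrix n n ℂ := Matrix.diagonal (fun i => ((hM.eigenvalues i : ℝ) : ℂ)) with hD
  set E : Matrix n n ℂ := Matrix.diagonal (fun i => (((hM.eigenvalues i)⁻¹ : ℝ) : ℂ)) with hE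
  have hMe : M = U * D * Uᴴ := by
    conv_lhs => rw [hM.spectral_theorem]
    rfl
  have hPe : hermPinv hM = U * E * Uᴴ := rfl
  have key : ∀ X Y : Matrix n n ℂ, U * X * Uᴴ * (U * Y * Uᴴ) = U * (X * Y) * Uᴴ := by
    intro X Y
    calc U * X * Uᴴ * (U * Y * Uᴴ) = U * X * (Uᴴ * U) * Y * Uᴴ := by simp only [Matrix.mul_assoc]
      _ = _ := by rw [h1]; simp only [Matrix.mul_assoc, Matrix.mul_one]
  have hDE : D * E = E * D := by
    simp only [hD, hE, Matrix.diagonal_mul_diagonal, mul_comm]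
  have hDED : D * E * D = D := by
    simp only [hD, hE, Matrix.diagonal_mul_diagonal]
    congr 1; funext i
    by_cases h : hM.eigenvalues i = 0
    · simp [h]
    · have : ((hM.eigenvalues i : ℝ) : ℂ) ≠ 0 := by exact_mod_cast h
      push_cast; field_simp
  have hEDE : E * D * E = E := by
    simp only [hD, hE, Matrix.diagonal_mul_diagonal]
    congr 1; funext i
    by_cases h : hM.eigenvalues i = 0
    · simp [h]
    · have : ((hM.eigenvalues i : ℝ) : ℂ) ≠ 0 := by exact_mod_cast h
      push_cast; field_simp
  have hEh : Eᴴ = E := by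
    rw [hE, Matrix.diagonal_conjTranspose]; congr 1; funext i; simp
  have hDEh : (D * E)ᴴ = D * E := by
    rw [hDE, Matrix.conjTranspose_mul, hEh, ← hDE]
    congr 1
    rw [hD, Matrix.diagonal_conjTranspose]; congr 1; funext i; simp
  have hconj : ∀ X : Matrix n n ℂ, (U * X * Uᴴ)ᴴ = U * Xᴴ * Uᴴ := by
    intro X; simp [Matrix.conjTranspose_mul, Matrix.mul_assoc]
  rw [hPe]
  refine ⟨⟨?_, ?_, ?_, ?_⟩, ?_, ?_⟩
  · conv_rhs => rw [hMe]
    conv_lhs => rw [hMe]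
    rw [key, key, hDED]
  · rw [hMe, key, key, hEDE]
  · rw [hMe, key, hconj, hDEh]
  · rw [hMe, key, hconj, ← hDE, hDEh]
  · rw [hconj, hEh]
  · rw [hMe, key, key, hDE]

/-- `pinv` is the Moore-Penrose pseudo-inverse. -/
theorem pinv_isMoorePenrose (M : Matrix m n ℂ) : IsMoorePenrose M (pinv M) := by
  obtain ⟨hP, hh, hc⟩ := hermPinv_spec (Matrix.isHermitian_conjTranspose_mul_self M)
  set Q := hermPinv (Matrix.isHermitian_conjTranspose_mul_self M) with hQ
  have hpe : pinv M = Q * Mᴴ := rfl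
  have hz : M * (Q * (Mᴴ * M)) - M = 0 := by
    rw [← Matrix.conjTranspose_mul_self_eq_zero]
    have e : (M * (Q * (Mᴴ * M)) - M)ᴴ * (M * (Q * (Mᴴ * M)) - M)
        = ((Q * (Mᴴ * M))ᴴ - 1) * (Mᴴ * M * Q * (Mᴴ * M) - Mᴴ * M) := by
      rw [Matrix.conjTranspose_sub, Matrix.conjTranspose_mul]
      simp only [Matrix.sub_mul, Matrix.mul_sub, Matrix.mul_assoc, Matrix.one_mul]
    rw [e, hP.mul_mul_self, sub_self, Matrix.mul_zero]
  have hA : M * (Q * (Mᴴ * M)) = M := sub_eq_zero.1 hz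
  rw [hpe]
  refine ⟨?_, ?_, ?_, ?_⟩
  · simpa only [Matrix.mul_assoc] using hA
  · have := congrArg (· * Mᴴ) hP.self_mul_mul
    simpa only [Matrix.mul_assoc] using this
  · simp [Matrix.conjTranspose_mul, hh, Matrix.mul_assoc]
  · simpa only [Matrix.mul_assoc] using hP.right_herm

end PseudoInverse

/-! ### Circularly symmetric complex Gaussian vectors -/

/-- The law `CN(0, 1)` on `ℂ`: independent real and imaginary parts, of variance `1 / 2` each, so
that `E |w|² = 1`. -/
def stdComplexGaussian : Measure ℂ :=
  ((gaussianReal 0 (1 / 2)).prod (gaussianReal 0 (1 / 2))).map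
    Complex.measurableEquivRealProd.symm

variable {ι β ε : Type*} [Fintype ι] [Fintype β] [Fintype ε]
  [DecidableEq ι] [DecidableEq β] [DecidableEq ε]

/-- The circularly symmetric (proper) complex Gaussian law `N(0, K)` on `ℂ^ι`: the law of
`K^{1/2} w`, where `w` has independent `CN(0, 1)` entries, so that the covariance matrix
`E[x xᴴ]` is `K`. This is meant for positive semidefinite `K`. -/
def complexGaussian (K : Matrix ι ι ℂ) : Measure (ι → ℂ) :=
  (Measure.pi fun _ : ι => stdComplexGaussian).map fun w => CFC.sqrt K *ᵥ w

/-- The linear Gaussian channel `x ↦ N(M x, K)`, that is `x ↦ M x + ω` with `ω ∼ N(0, K)`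
independent of the input. -/
def gaussianChannel (M : Matrix β ι ℂ) (K : Matrix β β ℂ) : Kernel (ι → ℂ) (β → ℂ) :=
  (Kernel.deterministic (fun x : ι → ℂ => M *ᵥ x) (by fun_prop) ×ₖ
    Kernel.const (ι → ℂ) (complexGaussian K)).map fun p => p.1 + p.2

/-! ### The game -/

/-- The covariance matrix `σ² I` of white noise. -/
def whiteCov (β : Type*) [DecidableEq β] (σ : ℝ) : Matrix β β ℂ := ((σ ^ 2 : ℝ) : ℂ) • 1

/-- The payoff `f(p_x, p_{v|z}) = D(p_{xv} ‖ p_{xy})`. Here `y = A x + ω_B` with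
`ω_B ∼ N(0, σB² I)`, `z = F x + ω_E` with `ω_E ∼ N(0, σE² I)`, and `v` is drawn from `z` through
`attack`, so that `v` and `x` are conditionally independent given `z`. -/
def payoff (A : Matrix β ι ℂ) (F : Matrix ε ι ℂ) (σB σE : ℝ)
    (px : Measure (ι → ℂ)) (attack : Kernel (ε → ℂ) (β → ℂ)) : ℝ≥0∞ :=
  klDiv (px ⊗ₘ (attack ∘ₖ gaussianChannel F (whiteCov ε σE)))
    (px ⊗ₘ gaussianChannel A (whiteCov β σB))

/-- The laws of the transmitted word with finite second moments and `E[x xᴴ] = Kx`. -/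
def defenses (Kx : Matrix ι ι ℂ) : Set (Measure (ι → ℂ)) :=
  {p | IsProbabilityMeasure p ∧ MemLp id 2 p ∧
    ∀ i j, ∫ x, x i * (starRingEnd ℂ) (x j) ∂p = Kx i j}

/-- The attacks: all the conditional laws of `v` given `z`. -/
def attacks (β ε : Type*) : Set (Kernel (ε → ℂ) (β → ℂ)) := {q | IsMarkovKernel q}

/-- The gain `G⋆ = A Kx Fᴴ (F Kx Fᴴ)†`. -/
def optGain (A : Matrix β ι ℂ) (F : Matrix ε ι ℂ) (Kx : Matrix ι ι ℂ) : Matrix β ε ℂ :=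
  A * Kx * Fᴴ * pinv (F * Kx * Fᴴ)

/-- The matrix `σB² I - σE² A Kx Fᴴ [(F Kx Fᴴ)†]² F Kx Aᴴ - σB'² I` prescribed for `C⋆ C⋆ᴴ`, where
`σB'` belongs to the receiver noise under attack. -/
def optNoiseCov (A : Matrix β ι ℂ) (F : Matrix ε ι ℂ) (Kx : Matrix ι ι ℂ) (σB σE σB' : ℝ) :
    Matrix β β ℂ :=
  whiteCov β σB
    - ((σE ^ 2 : ℝ) : ℂ) • (A * Kx * Fᴴ * pinv (F * Kx * Fᴴ) ^ 2 * F * Kx * Aᴴ)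
    - whiteCov β σB'

/-- The attack `p⋆_{v|z} = N(G⋆ z, C Cᴴ + σB'² I)`, that is `v = G⋆ z + C ω_c + ω_B'` with
independent `ω_c ∼ N(0, I)` and `ω_B' ∼ N(0, σB'² I)`. -/
def optAttack (A : Matrix β ι ℂ) (F : Matrix ε ι ℂ) (Kx : Matrix ι ι ℂ) (σB' : ℝ)
    (C : Matrix β β ℂ) : Kernel (ε → ℂ) (β → ℂ) :=
  gaussianChannel (optGain A F Kx) (C * Cᴴ + whiteCov β σB')

end Spoofing

end

noncomputable section

namespace Spoofing

/-! ### Densities of product and image measures -/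

/-! Write G for the optimal gain. The covariance of `C` is chosen so that the noise relayed through
G, plus the attacker's own noise, is exactly σB² I (`optGain_noise_add`). Hence under the optimal
attack v given x is N(G F x, σB² I), which differs from the legitimate channel only in its mean. The
divergence is E‖(A - G F) x‖² / σB², a function of E[x xᴴ] alone, so all admissible laws give the
same payoff (`payoff_optAttack`).

Optimality against Gaussian input comes from a symmetry. The matrix R = 2 Kx Fᴴ (F Kx Fᴴ)† F - 1 is
an involution that preserves N(0, Kx), fixes F x almost surely, and satisfies A R = 2 G F - A. An
attack sees x only through F x, so applying R to the first coordinate leaves p_{xv} unchanged, while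
it turns the mean A x of the legitimate channel into its mirror image about G F x. By data
processing, the divergence D' of p_{xv} from the mirrored channel is at most the payoff D. The
parallelogram law for the Gaussian exponents gives D + D' = 2 D₀ + 2 E‖(A - G F) x‖² / σB², where D₀
≥ 0 is the divergence from the channel with mean G F x. Thus D is at least the equilibrium value
(`le_klDiv_of_klDiv_mirror_le`, `le_payoff_complexGaussian`). -/

theorem map_withDensity_comp {α β : Type*} {mα : MeasurableSpace α} {mβ : MeasurableSpace β}
    (μ : Measure α) {g : α → β} (hg : Measurable g) {f : β → ℝ≥0∞} (hf : Measurable f) :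
    (μ.withDensity (f ∘ g)).map g = (μ.map g).withDensity f := by
  ext s hs
  rw [Measure.map_apply hg hs, withDensity_apply _ (hg hs), withDensity_apply _ hs,
    setLIntegral_map hs hf hg]
  rfl

/-- It suffices to test on boxes. The indicator of a box factors over the coordinates, so
independence turns the integral into a product. -/
theorem pi_withDensity {ι : Type*} [Fintype ι] {X : ι → Type*} [∀ i, MeasurableSpace (X i)]
    (μ : ∀ i, Measure (X i)) [∀ i, IsProbabilityMeasure (μ i)] {f : ∀ i, X i → ℝ≥0∞}
    (hf : ∀ i, Measurable (f i)) [∀ i, SigmaFinite ((μ i).withDensity (f i))] :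
    Measure.pi (fun i => (μ i).withDensity (f i)) =
      (Measure.pi μ).withDensity fun x => ∏ i, f i (x i) := by
  refine Measure.pi_eq fun s hs => ?_
  have hind : ∀ x : (∀ i, X i), (Set.univ.pi s).indicator (fun x => ∏ i, f i (x i)) x =
      ∏ i, (s i).indicator (f i) (x i) := by
    intro x
    by_cases hx : x ∈ Set.univ.pi s
    · rw [Set.indicator_of_mem hx]
      exact Finset.prod_congr rfl fun i _ => (Set.indicator_of_mem (hx i trivial) _).symm
    · rw [Set.indicator_of_notMem hx]
      simp only [Set.mem_pi, Set.mem_univ, true_implies, not_forall] at hx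
      obtain ⟨i, hi⟩ := hx
      exact (Finset.prod_eq_zero (Finset.mem_univ i) (Set.indicator_of_notMem hi _)).symm
  have hm : ∀ i, Measurable ((s i).indicator (f i)) := fun i => (hf i).indicator (hs i)
  rw [withDensity_apply _ (MeasurableSet.univ_pi hs), ← lintegral_indicator (MeasurableSet.univ_pi hs),
    lintegral_congr hind, lintegral_prod_eq_prod_lintegral_of_indepFun Finset.univ
      (fun i (x : ∀ i, X i) => (s i).indicator (f i) (x i))
      (iIndepFun_pi fun i => (hm i).aemeasurable) fun i => (hm i).comp (measurable_pi_apply i)]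
  refine Finset.prod_congr rfl fun i _ => ?_
  rw [withDensity_apply _ (hs i), ← lintegral_indicator (hs i),
    ← (measurePreserving_eval μ i).lintegral_comp (hm i)]

/-! ### Translates of Gaussian laws -/

/-- With variance 1/2 the Gaussian exponent is -x², so the density of the shift carries no constant.
-/
theorem gaussianReal_half_map_add (a : ℝ) :
    (gaussianReal 0 (1 / 2)).map (fun x => x + a) =
      (gaussianReal 0 (1 / 2)).withDensity
        fun x => ENNReal.ofReal (Real.exp (x ^ 2 - (x - a) ^ 2)) := by
  have hv : (1 / 2 : ℝ≥0) ≠ 0 := by norm_num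
  rw [gaussianReal_map_add_const, gaussianReal_of_var_ne_zero _ hv, gaussianReal_of_var_ne_zero _ hv,
    ← withDensity_mul _ (by fun_prop) (by fun_prop)]
  congr 1
  ext x
  simp only [Pi.mul_apply, gaussianPDF, gaussianPDFReal]
  rw [← ENNReal.ofReal_mul (by positivity), mul_assoc _ (Real.exp _), ← Real.exp_add]
  congr 3
  push_cast
  ring

instance : IsProbabilityMeasure stdComplexGaussian :=
  Measure.isProbabilityMeasure_map (by fun_prop)

theorem stdComplexGaussian_map_add (a : ℂ) :
    stdComplexGaussian.map (fun z => z + a) =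
      stdComplexGaussian.withDensity
        fun z => ENNReal.ofReal (Real.exp (‖z‖ ^ 2 - ‖z - a‖ ^ 2)) := by
  have hm : Measurable fun z : ℂ => ENNReal.ofReal (Real.exp (‖z‖ ^ 2 - ‖z - a‖ ^ 2)) := by
    fun_prop
  have hmap : (fun z => z + a) ∘ Complex.measurableEquivRealProd.symm =
      Complex.measurableEquivRealProd.symm ∘ Prod.map (fun x => x + a.re) (fun x => x + a.im) := by
    ext p; apply Complex.ext <;> simp [Complex.measurableEquivRealProd]
  rw [stdComplexGaussian, Measure.map_map (by fun_prop) (by fun_prop), hmap,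
    ← Measure.map_map (by fun_prop) (by fun_prop),
    ← Measure.map_prod_map _ _ (by fun_prop) (by fun_prop),
    gaussianReal_half_map_add, gaussianReal_half_map_add,
    prod_withDensity (by fun_prop) (by fun_prop), ← map_withDensity_comp _ (by fun_prop) hm]
  congr 2
  ext p
  rw [← ENNReal.ofReal_mul (by positivity), ← Real.exp_add]
  simp only [Function.comp, Complex.sq_norm, Complex.normSq_apply]
  congr 2
  simp [Complex.measurableEquivRealProd]
  ring

variable {ι κ κ' β ε : Type*} [Fintype ι] [Fintype κ] [Fintype κ'] [Fintype β] [Fintype ε]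

/-- The squared Euclidean norm of a complex vector. -/
def normSqSum (v : β → ℂ) : ℝ := ∑ i, ‖v i‖ ^ 2

@[fun_prop]
theorem measurable_normSqSum : Measurable (normSqSum : (β → ℂ) → ℝ) := by
  unfold normSqSum; fun_prop

/-- The law of a vector with independent `CN(0, 1)` entries. -/
def stdVec (ι : Type*) [Fintype ι] : Measure (ι → ℂ) :=
  Measure.pi fun _ : ι => stdComplexGaussian

instance : IsProbabilityMeasure (stdVec ι) := by unfold stdVec; infer_instance

theorem stdVec_map_add (a : ι → ℂ) :
    (stdVec ι).map (fun w => w + a) =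
      (stdVec ι).withDensity
        fun w => ENNReal.ofReal (Real.exp (normSqSum w - normSqSum (w - a))) := by
  have hp : ∀ i, IsProbabilityMeasure (stdComplexGaussian.map fun z => z + a i) := fun i =>
    Measure.isProbabilityMeasure_map (by fun_prop)
  have h1 : (fun w : ι → ℂ => w + a) = fun w i => (fun z => z + a i) (w i) := rfl
  have hs : ∀ i, SigmaFinite (stdComplexGaussian.withDensity
        fun z => ENNReal.ofReal (Real.exp (‖z‖ ^ 2 - ‖z - a i‖ ^ 2))) := by
    intro i
    rw [← stdComplexGaussian_map_add]
    infer_instance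
  rw [stdVec, h1, Measure.pi_map_pi (f := fun i z => z + a i) (fun i => by fun_prop)]
  simp_rw [stdComplexGaussian_map_add]
  rw [pi_withDensity _ (fun i => by fun_prop)]
  congr 1
  ext w
  rw [← ENNReal.ofReal_prod_of_nonneg (fun i _ => (Real.exp_pos _).le), ← Real.exp_sum]
  simp [normSqSum, Finset.sum_sub_distrib]

/-! ### Linear images of Gaussian laws -/

instance : IsGaussian stdComplexGaussian := by
  have h : stdComplexGaussian = ((gaussianReal 0 (1 / 2)).prod (gaussianReal 0 (1 / 2))).map
    Complex.equivRealProdCLM.symm := rfl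
  rw [h]
  infer_instance

theorem charFunDual_stdComplexGaussian (L : StrongDual ℝ ℂ) :
    charFunDual stdComplexGaussian L =
      Complex.exp (-(((L 1) ^ 2 + (L Complex.I) ^ 2 : ℝ) : ℂ) / 4) := by
  have h : stdComplexGaussian = ((gaussianReal 0 (1 / 2)).prod (gaussianReal 0 (1 / 2))).map
    (Complex.equivRealProdCLM.symm : ℝ × ℝ →L[ℝ] ℂ) := rfl
  have hreal : ∀ M : StrongDual ℝ ℝ, charFunDual (gaussianReal 0 (1 / 2)) M =
      Complex.exp (-(((M 1) ^ 2 : ℝ) : ℂ) / 4) := by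
    intro M
    have hM : (M : ℝ → ℝ) = fun x => M 1 * x := by
      ext x
      rw [mul_comm, ← smul_eq_mul, ← map_smul, smul_eq_mul, mul_one]
    rw [charFunDual_eq_charFun_map_one, hM, gaussianReal_map_const_mul, charFun_gaussianReal]
    congr 1
    push_cast
    simp
    ring
  rw [h, charFunDual_map, charFunDual_prod, hreal, hreal, ← Complex.exp_add]
  congr 1
  have h1 : (Complex.equivRealProdCLM.symm (1, 0) : ℂ) = 1 := by
    apply Complex.ext <;> simp
  have h2 : (Complex.equivRealProdCLM.symm (0, 1) : ℂ) = Complex.I := by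
    apply Complex.ext <;> simp
  simp [h1, h2]
  ring

/-- The vector `t` for which a real linear form on `ℂ^κ` is `v ↦ Re ∑ t_k v_k`. -/
def dualCoeff [DecidableEq κ] (L : StrongDual ℝ (κ → ℂ)) : κ → ℂ :=
  fun k => L (Pi.single k 1) - Complex.I * L (Pi.single k Complex.I)

/-- Circular symmetry makes `B` enter only through `B * Bᴴ`; identifying and adding Gaussian laws
both rest on this. -/
theorem charFunDual_stdVec_map [DecidableEq ι] [DecidableEq κ] (B : Matrix κ ι ℂ)
    (L : StrongDual ℝ (κ → ℂ)) :
    charFunDual ((stdVec ι).map fun w => B *ᵥ w) L =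
      Complex.exp (-(dualCoeff L ⬝ᵥ ((B * Bᴴ) *ᵥ star (dualCoeff L))) / 4) := by
  set t := dualCoeff L with ht
  have hL : ∀ v, L v = (t ⬝ᵥ v).re := by
    intro v
    have hv : v = ∑ k, ((v k).re • (Pi.single k 1 : κ → ℂ) +
        (v k).im • (Pi.single k Complex.I : κ → ℂ)) := by
      ext j
      simp [Finset.sum_apply, Pi.single_apply, Finset.sum_add_distrib, Complex.re_add_im]
    conv_lhs => rw [hv]
    simp [map_sum, dotProduct, ht, dualCoeff]
    refine Finset.sum_congr rfl fun k _ => by ring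
  let BL : (ι → ℂ) →L[ℝ] (κ → ℂ) := (B.mulVecLin.restrictScalars ℝ).toContinuousLinearMap
  have hBL : (fun w => B *ᵥ w) = BL := rfl
  rw [hBL, charFunDual_map, stdVec, charFunDual_pi]
  simp_rw [charFunDual_stdComplexGaussian]
  rw [← Complex.exp_sum]
  congr 1
  have hcol : ∀ i (c : ℂ), L (BL (Pi.single i c)) = ((t ᵥ* B) i * c).re := by
    intro i c
    rw [hL]
    change (t ⬝ᵥ (B *ᵥ Pi.single i c)).re = _
    rw [Matrix.dotProduct_mulVec, dotProduct_single]
  rw [← Matrix.mulVec_mulVec, Matrix.dotProduct_mulVec, ← Matrix.star_vecMul, dotProduct,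
    ← Finset.sum_div, ← Finset.sum_neg_distrib]
  congr 1
  refine Finset.sum_congr rfl fun i _ => ?_
  -- The values of the form on the real and imaginary directions are Re z and -Im z, so their
  -- squares add up to |z|².
  have e : ∀ z : ℂ, ((z.re ^ 2 + (z * Complex.I).re ^ 2 : ℝ) : ℂ) = z * star z := by
    intro z
    rw [Complex.star_def, Complex.mul_conj, Complex.normSq_apply]
    simp
    ring
  have e1 : ((L.comp BL).comp (ContinuousLinearMap.single ℝ (fun _ : ι => ℂ) i)) 1 =
      ((t ᵥ* B) i).re := by
    simpa using hcol i 1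
  have e2 : ((L.comp BL).comp (ContinuousLinearMap.single ℝ (fun _ : ι => ℂ) i)) Complex.I =
      ((t ᵥ* B) i * Complex.I).re := hcol i Complex.I
  rw [e1, e2, e]
  rfl

theorem stdVec_map_mulVec_congr {B : Matrix κ ι ℂ} {B' : Matrix κ κ' ℂ}
    (h : B * Bᴴ = B' * B'ᴴ) :
    (stdVec ι).map (fun w => B *ᵥ w) = (stdVec κ').map fun w => B' *ᵥ w := by
  classical
  have := Measure.isProbabilityMeasure_map (μ := stdVec ι) (f := fun w => B *ᵥ w) (by fun_prop)
  have := Measure.isProbabilityMeasure_map (μ := stdVec κ') (f := fun w => B' *ᵥ w) (by fun_prop)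
  refine Measure.ext_of_charFunDual ?_
  ext L
  rw [charFunDual_stdVec_map, charFunDual_stdVec_map, h]

theorem stdVec_prod_map_add {μ ν : Measure (κ → ℂ)} {ι' : Type*} [Fintype ι'] {B : Matrix κ ι ℂ}
    {B' : Matrix κ ι' ℂ} {C : Matrix κ κ' ℂ}
    (hμ : μ = (stdVec ι).map fun w => B *ᵥ w) (hν : ν = (stdVec ι').map fun w => B' *ᵥ w)
    (h : B * Bᴴ + B' * B'ᴴ = C * Cᴴ) :
    (μ.prod ν).map (fun p => p.1 + p.2) = (stdVec κ').map fun w => C *ᵥ w := by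
  classical
  have := Measure.isProbabilityMeasure_map (μ := stdVec ι) (f := fun w => B *ᵥ w) (by fun_prop)
  have := Measure.isProbabilityMeasure_map (μ := stdVec ι') (f := fun w => B' *ᵥ w) (by fun_prop)
  have := Measure.isProbabilityMeasure_map (μ := stdVec κ') (f := fun w => C *ᵥ w) (by fun_prop)
  have : IsProbabilityMeasure μ := hμ ▸ inferInstance
  have : IsProbabilityMeasure ν := hν ▸ inferInstance
  have := Measure.isProbabilityMeasure_map (μ := μ.prod ν)
    (f := fun p : (κ → ℂ) × (κ → ℂ) => p.1 + p.2) (by fun_prop)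
  refine Measure.ext_of_charFunDual ?_
  ext L
  rw [charFunDual_map_add_prod_eq_mul, Pi.mul_apply, hμ, hν, charFunDual_stdVec_map,
    charFunDual_stdVec_map, charFunDual_stdVec_map, ← Complex.exp_add, ← h, Matrix.add_mulVec,
    dotProduct_add]
  congr 1
  ring

end Spoofing

end

noncomputable section

namespace Spoofing

variable {ι κ β ε : Type*} [Fintype ι] [Fintype κ] [Fintype β] [Fintype ε]

theorem normSqSum_smul (σ : ℝ) (v : β → ℂ) : normSqSum ((σ : ℂ) • v) = σ ^ 2 * normSqSum v := by
  simp [normSqSum, Finset.mul_sum, mul_pow]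

/-- The log-density of `N(A x, σ² I)` with respect to `N(B x, σ² I)`. -/
def channelLogDensity (A B : Matrix β ι ℂ) (σ : ℝ) (x : ι → ℂ) (v : β → ℂ) : ℝ :=
  (normSqSum (v - B *ᵥ x) - normSqSum (v - A *ᵥ x)) / σ ^ 2

theorem measurable_channelLogDensity (A B : Matrix β ι ℂ) (σ : ℝ) :
    Measurable (Function.uncurry (channelLogDensity A B σ)) := by
  unfold channelLogDensity Function.uncurry
  fun_prop

/-! ### Gaussian laws through covariance factors, and composition of Gaussian channels -/

section Gaussian

variable [DecidableEq β] [DecidableEq ε]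

theorem sqrt_mul_conjTranspose_sqrt [DecidableEq ι] {K : Matrix ι ι ℂ} (hK : K.PosSemidef) :
    CFC.sqrt K * (CFC.sqrt K)ᴴ = K := by
  have h : (CFC.sqrt K)ᴴ = CFC.sqrt K := (Matrix.nonneg_iff_posSemidef.1 (CFC.sqrt_nonneg K)).isHermitian
  rw [h, CFC.sqrt_mul_sqrt_self K hK.nonneg]

/-- Any factor of the covariance, even a rectangular one, may replace the square root in the
definition. -/
theorem complexGaussian_eq_map_stdVec [DecidableEq ι] {K : Matrix ι ι ℂ} {B : Matrix ι κ ℂ} (h : B * Bᴴ = K) :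
    complexGaussian K = (stdVec κ).map fun w => B *ᵥ w := by
  have hK : K.PosSemidef := h ▸ Matrix.posSemidef_self_mul_conjTranspose B
  exact stdVec_map_mulVec_congr ((sqrt_mul_conjTranspose_sqrt hK).trans h.symm)

theorem posSemidef_whiteCov (σ : ℝ) : (whiteCov β σ).PosSemidef := by
  have h : whiteCov β σ = ((σ : ℂ) • (1 : Matrix β β ℂ)) * ((σ : ℂ) • (1 : Matrix β β ℂ))ᴴ := by
    simp [whiteCov, smul_smul, pow_two, -Complex.coe_smul]
  rw [h]
  exact Matrix.posSemidef_self_mul_conjTranspose _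

theorem complexGaussian_whiteCov (σ : ℝ) :
    complexGaussian (whiteCov β σ) = (stdVec β).map fun w => (σ : ℂ) • w := by
  rw [complexGaussian_eq_map_stdVec (B := (σ : ℂ) • (1 : Matrix β β ℂ))]
  · simp [Matrix.smul_mulVec]
  · simp [whiteCov, smul_smul, pow_two, -Complex.coe_smul]

instance [DecidableEq ι] (K : Matrix ι ι ℂ) : IsProbabilityMeasure (complexGaussian K) :=
  Measure.isProbabilityMeasure_map (μ := stdVec ι) (f := fun w => CFC.sqrt K *ᵥ w) (by fun_prop)

instance (M : Matrix β ι ℂ) (K : Matrix β β ℂ) : IsMarkovKernel (gaussianChannel M K) :=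
  Kernel.IsMarkovKernel.map _ (by fun_prop)

theorem gaussianChannel_apply (M : Matrix β ι ℂ) (K : Matrix β β ℂ) (x : ι → ℂ) :
    gaussianChannel M K x = (complexGaussian K).map fun w => M *ᵥ x + w := by
  rw [gaussianChannel, Kernel.map_apply _ (by fun_prop), Kernel.prod_apply,
    Kernel.deterministic_apply, Kernel.const_apply, Measure.dirac_prod,
    Measure.map_map (by fun_prop) (by fun_prop)]
  rfl

theorem compProd_gaussianChannel (p : Measure (ι → ℂ)) [IsProbabilityMeasure p]
    (M : Matrix β ι ℂ) (K : Matrix β β ℂ) :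
    p ⊗ₘ gaussianChannel M K =
      (p.prod (complexGaussian K)).map fun q => (q.1, M *ᵥ q.1 + q.2) := by
  have hm : Measurable fun q : (ι → ℂ) × (β → ℂ) => (q.1, M *ᵥ q.1 + q.2) := by fun_prop
  ext s hs
  rw [Measure.compProd_apply hs, Measure.map_apply hm hs, Measure.prod_apply (hm hs)]
  refine lintegral_congr fun x => ?_
  rw [gaussianChannel_apply, Measure.map_apply (by fun_prop) (measurable_prodMk_left hs)]
  rfl

/-- Gaussian channels with the same covariance compose to a Gaussian channel. -/
theorem gaussianChannel_comp (F : Matrix ε ι ℂ) (G : Matrix β ε ℂ) {K₁ : Matrix ε ε ℂ}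
    {K₂ K : Matrix β β ℂ} (h₁ : K₁.PosSemidef) (h₂ : K₂.PosSemidef) (h : G * K₁ * Gᴴ + K₂ = K) :
    gaussianChannel G K₂ ∘ₖ gaussianChannel F K₁ = gaussianChannel (G * F) K := by
  have hK : K.PosSemidef := h ▸ (h₁.mul_mul_conjTranspose_same G).add h₂
  ext x s hs
  have hms : MeasurableSet ((fun w => (G * F) *ᵥ x + w) ⁻¹' s) :=
    (by fun_prop : Measurable fun w : β → ℂ => (G * F) *ᵥ x + w) hs
  -- The total noise is G ω₁ + ω₂ with independent terms of covariance G K₁ Gᴴ and K₂. After this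
  -- rewrite both sides are integrals over ω₁.
  have hsum : complexGaussian K = (((complexGaussian K₁).map fun a => G *ᵥ a).prod
      (complexGaussian K₂)).map fun p => p.1 + p.2 := by
    refine (stdVec_prod_map_add (B := G * CFC.sqrt K₁) (B' := CFC.sqrt K₂) (C := CFC.sqrt K)
      ?_ rfl ?_).symm
    · rw [complexGaussian, Measure.map_map (by fun_prop) (by fun_prop)]
      congr 1
      ext w
      simp [Function.comp]
    · rw [sqrt_mul_conjTranspose_sqrt hK, sqrt_mul_conjTranspose_sqrt h₂, ← h,
        Matrix.conjTranspose_mul, ← Matrix.mul_assoc, Matrix.mul_assoc G,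
        sqrt_mul_conjTranspose_sqrt h₁]
  have hms' : MeasurableSet ((fun p : (β → ℂ) × (β → ℂ) => p.1 + p.2) ⁻¹'
      ((fun w => (G * F) *ᵥ x + w) ⁻¹' s)) :=
    (by fun_prop : Measurable fun p : (β → ℂ) × (β → ℂ) => p.1 + p.2) hms
  rw [Kernel.comp_apply' _ _ _ hs, gaussianChannel_apply F, gaussianChannel_apply (G * F),
    Measure.map_apply (by fun_prop) hs, hsum, Measure.map_apply (by fun_prop) hms,
    Measure.prod_apply hms', lintegral_map (Kernel.measurable_coe _ hs) (by fun_prop),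
    lintegral_map (measurable_measure_prodMk_left hms') (by fun_prop)]
  refine lintegral_congr fun w => ?_
  rw [gaussianChannel_apply, Measure.map_apply (by fun_prop) hs]
  congr 1
  ext v
  simp [Matrix.mulVec_add, add_assoc]

/-! ### Gaussian channels with white noise -/

theorem complexGaussian_whiteCov_map_add (a b : β → ℂ) {σ : ℝ} (hσ : 0 < σ) :
    (complexGaussian (whiteCov β σ)).map (fun w => a + w) =
      ((complexGaussian (whiteCov β σ)).map fun w => b + w).withDensity
        fun v => ENNReal.ofReal (Real.exp ((normSqSum (v - b) - normSqSum (v - a)) / σ ^ 2)) := by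
  have hσ' : (σ : ℂ) ≠ 0 := by exact_mod_cast hσ.ne'
  -- Rescaled by σ, the difference of the two means is a shift of the standard vector.
  obtain ⟨c, hc⟩ : ∃ c : β → ℂ, (σ : ℂ) • c = a - b :=
    ⟨(σ : ℂ)⁻¹ • (a - b), by rw [smul_smul, mul_inv_cancel₀ hσ', one_smul]⟩
  have hg : Measurable fun w : β → ℂ => b + (σ : ℂ) • w := by fun_prop
  have h1 : (fun w : β → ℂ => a + (σ : ℂ) • w) =
      (fun w => b + (σ : ℂ) • w) ∘ fun w => w + c := by
    ext1 w
    simp only [Function.comp, smul_add, hc]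
    abel
  have hmap : ∀ d : β → ℂ, (complexGaussian (whiteCov β σ)).map (fun w => d + w) =
      (stdVec β).map fun w => d + (σ : ℂ) • w := by
    intro d
    rw [complexGaussian_whiteCov, Measure.map_map (by fun_prop) (by fun_prop)]
    rfl
  have hexp : ∀ w : β → ℂ, normSqSum w - normSqSum (w - c) =
      (normSqSum (b + (σ : ℂ) • w - b) - normSqSum (b + (σ : ℂ) • w - a)) / σ ^ 2 := by
    intro w
    have h2 : b + (σ : ℂ) • w - a = (σ : ℂ) • (w - c) := by
      rw [smul_sub, hc]; abel
    rw [add_sub_cancel_left, h2, normSqSum_smul, normSqSum_smul, ← mul_sub,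
      mul_div_cancel_left₀ _ (by positivity)]
  rw [hmap, hmap, h1, ← Measure.map_map hg (by fun_prop), stdVec_map_add,
    ← map_withDensity_comp _ hg (by fun_prop)]
  simp only [hexp]
  rfl

theorem gaussianChannel_whiteCov_withDensity (A B : Matrix β ι ℂ) {σ : ℝ} (hσ : 0 < σ) :
    gaussianChannel A (whiteCov β σ) = (gaussianChannel B (whiteCov β σ)).withDensity
      fun x v => ENNReal.ofReal (Real.exp (channelLogDensity A B σ x v)) := by
  have hm := measurable_channelLogDensity A B σ
  ext1 x
  rw [Kernel.withDensity_apply _ (hm.exp.ennreal_ofReal), gaussianChannel_apply,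
    gaussianChannel_apply]
  exact complexGaussian_whiteCov_map_add _ _ hσ

theorem compProd_gaussianChannel_withDensity (p : Measure (ι → ℂ)) [IsProbabilityMeasure p]
    (A B : Matrix β ι ℂ) {σ : ℝ} (hσ : 0 < σ) :
    p ⊗ₘ gaussianChannel A (whiteCov β σ) =
      (p ⊗ₘ gaussianChannel B (whiteCov β σ)).withDensity
        fun q => ENNReal.ofReal (Real.exp (channelLogDensity A B σ q.1 q.2)) := by
  have hm := measurable_channelLogDensity A B σ
  have h := gaussianChannel_whiteCov_withDensity A B hσ
  have : IsSFiniteKernel ((gaussianChannel B (whiteCov β σ)).withDensity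
      fun x v => ENNReal.ofReal (Real.exp (channelLogDensity A B σ x v))) := h ▸ inferInstance
  conv_lhs => rw [h]
  exact Measure.compProd_withDensity (by fun_prop)

end Gaussian

/-! ### Log-likelihood ratios -/

theorem absolutelyContinuous_withDensity_exp {α : Type*} {mα : MeasurableSpace α} (ν : Measure α)
    {g : α → ℝ} (hg : Measurable g) :
    ν ≪ ν.withDensity fun x => ENNReal.ofReal (Real.exp (g x)) :=
  withDensity_absolutelyContinuous' (by fun_prop)
    (Filter.Eventually.of_forall fun x => by simp [Real.exp_pos])

/-- Multiplying the reference measure by e^g divides the derivative by e^g. Absolute continuity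
keeps the derivative positive and finite μ-a.e., so the logarithm splits. -/
theorem llr_withDensity_exp {α : Type*} {mα : MeasurableSpace α} {μ ν : Measure α}
    [SigmaFinite μ] [SigmaFinite ν] (hμν : μ ≪ ν) {g : α → ℝ} (hg : Measurable g) :
    llr μ (ν.withDensity fun x => ENNReal.ofReal (Real.exp (g x))) =ᵐ[μ]
      fun x => llr μ ν x - g x := by
  have h := Measure.rnDeriv_withDensity_right μ ν
    (f := fun x => ENNReal.ofReal (Real.exp (g x))) (by fun_prop)
    (Filter.Eventually.of_forall fun x => by simp [Real.exp_pos])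
    (Filter.Eventually.of_forall fun x => by simp)
  filter_upwards [hμν.ae_le h, Measure.rnDeriv_pos hμν,
    hμν.ae_le (Measure.rnDeriv_lt_top μ ν)] with x hx hpos hlt
  rw [llr, llr, hx, ENNReal.toReal_mul, Real.log_mul, ENNReal.toReal_inv,
    ENNReal.toReal_ofReal (Real.exp_pos _).le, Real.log_inv, Real.log_exp]
  · ring
  · simp [ENNReal.toReal_eq_zero_iff, Real.exp_pos]
  · simp [ENNReal.toReal_eq_zero_iff, hpos.ne', hlt.ne]

end Spoofing

end

noncomputable section

namespace Spoofing

variable {ι κ β ε : Type*} [Fintype ι] [Fintype κ] [Fintype β] [Fintype ε]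

/-! ### Pseudo-inverses of Hermitian matrices and the reflection of the input -/

section Matrices

variable {m n : Type*} [Fintype m] [Fintype n]

/-- Both inverses equal X M Y. -/
theorem IsMoorePenrose.unique {M : Matrix m n ℂ} {X Y : Matrix n m ℂ} (hX : IsMoorePenrose M X)
    (hY : IsMoorePenrose M Y) : X = Y := by
  have h1 : X = X * (M * Y) := by
    calc X = X * (M * X) := by rw [← Matrix.mul_assoc, hX.self_mul_mul]
      _ = X * ((M * Y * M) * X)ᴴ := by rw [hY.mul_mul_self, hX.left_herm]
      _ = X * ((M * X)ᴴ * (M * Y)ᴴ) := by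
        rw [← Matrix.conjTranspose_mul, Matrix.mul_assoc (M * Y)]
      _ = X * M * X * (M * Y) := by
        rw [hX.left_herm, hY.left_herm]; simp only [Matrix.mul_assoc]
      _ = X * (M * Y) := by rw [hX.self_mul_mul]
  have h2 : Y = X * M * Y := by
    calc Y = Y * M * Y := hY.self_mul_mul.symm
      _ = (Y * (M * X * M))ᴴ * Y := by rw [hX.mul_mul_self, hY.right_herm]
      _ = ((X * M)ᴴ * (Y * M)ᴴ) * Y := by
        rw [← Matrix.conjTranspose_mul]; simp only [Matrix.mul_assoc]
      _ = X * M * (Y * M * Y) := by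
        rw [hX.right_herm, hY.right_herm]; simp only [Matrix.mul_assoc]
      _ = X * M * Y := by rw [hY.self_mul_mul]
  rw [h1, ← Matrix.mul_assoc, ← h2]

/-- The adjoint of the pseudo-inverse solves the Penrose equations of Mᴴ = M, the two symmetry
conditions being exchanged. -/
theorem isHermitian_pinv [DecidableEq n] {M : Matrix n n ℂ} (hM : M.IsHermitian) :
    (pinv M)ᴴ = pinv M := by
  have h := pinv_isMoorePenrose M
  refine IsMoorePenrose.unique (M := M) ⟨?_, ?_, ?_, ?_⟩ h
  · simpa [Matrix.conjTranspose_mul, hM.eq, Matrix.mul_assoc] using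
      congrArg Matrix.conjTranspose h.mul_mul_self
  · simpa [Matrix.conjTranspose_mul, hM.eq, Matrix.mul_assoc] using
      congrArg Matrix.conjTranspose h.self_mul_mul
  · simpa [Matrix.conjTranspose_mul, hM.eq] using h.right_herm.symm
  · simpa [Matrix.conjTranspose_mul, hM.eq] using h.left_herm.symm

variable [DecidableEq ε]

/-- Since the pseudo-inverse P of F Kx Fᴴ is Hermitian, G Gᴴ = A Kx Fᴴ P² F Kx Aᴴ, which is the term
subtracted in `optNoiseCov`. -/
theorem optGain_noise_add [DecidableEq β] (A : Matrix β ι ℂ) (F : Matrix ε ι ℂ) {Kx : Matrix ι ι ℂ}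
    (hKx : Kx.PosSemidef) {σB σE σB' : ℝ} {C : Matrix β β ℂ}
    (hC : C * Cᴴ = optNoiseCov A F Kx σB σE σB') :
    optGain A F Kx * whiteCov ε σE * (optGain A F Kx)ᴴ + (C * Cᴴ + whiteCov β σB') =
      whiteCov β σB := by
  have hP := isHermitian_pinv (hKx.mul_mul_conjTranspose_same F).isHermitian
  rw [hC, optNoiseCov, optGain, whiteCov, Matrix.conjTranspose_mul, hP]
  simp only [Matrix.conjTranspose_mul, Matrix.conjTranspose_conjTranspose, hKx.isHermitian.eq,
    pow_two (pinv _), Matrix.mul_smul, Matrix.smul_mul, Matrix.mul_one, Matrix.mul_assoc]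
  abel

/-- The reflection of the input which fixes `F x` and reverses `A x - G⋆ F x`. -/
def reflection [DecidableEq ι] (F : Matrix ε ι ℂ) (Kx : Matrix ι ι ℂ) : Matrix ι ι ℂ :=
  (2 : ℂ) • (Kx * Fᴴ * pinv (F * Kx * Fᴴ) * F) - 1

/-- The Penrose equation P M P = P makes E = Kx Fᴴ P F idempotent, and (2 E - 1)² = 1 for an
idempotent E. -/
theorem reflection_mul_self [DecidableEq ι] (F : Matrix ε ι ℂ) (Kx : Matrix ι ι ℂ) :
    reflection F Kx * reflection F Kx = 1 := by
  have h := (pinv_isMoorePenrose (F * Kx * Fᴴ)).self_mul_mul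
  set P := pinv (F * Kx * Fᴴ)
  have hE : (Kx * Fᴴ * P * F) * (Kx * Fᴴ * P * F) = Kx * Fᴴ * P * F := by
    calc (Kx * Fᴴ * P * F) * (Kx * Fᴴ * P * F) = Kx * Fᴴ * (P * (F * Kx * Fᴴ) * P) * F := by
          simp only [Matrix.mul_assoc]
      _ = _ := by rw [h]
  change ((2 : ℂ) • (Kx * Fᴴ * P * F) - 1) * ((2 : ℂ) • (Kx * Fᴴ * P * F) - 1) = 1
  rw [sub_mul, mul_sub, smul_mul_smul, hE, mul_one, one_mul]
  module

/-- R Kx is Hermitian, so R Kx Rᴴ = Kx (R R)ᴴ = Kx. -/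
theorem reflection_conj [DecidableEq ι] (F : Matrix ε ι ℂ) {Kx : Matrix ι ι ℂ} (hKx : Kx.PosSemidef) :
    reflection F Kx * Kx * (reflection F Kx)ᴴ = Kx := by
  have hP := isHermitian_pinv (hKx.mul_mul_conjTranspose_same F).isHermitian
  have hsymm : reflection F Kx * Kx = Kx * (reflection F Kx)ᴴ := by
    rw [reflection]
    set P := pinv (F * Kx * Fᴴ)
    simp only [Matrix.conjTranspose_sub, Matrix.conjTranspose_smul,
      Matrix.conjTranspose_mul, Matrix.conjTranspose_conjTranspose, hKx.isHermitian.eq, hP,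
      Matrix.conjTranspose_one, Matrix.sub_mul, Matrix.mul_sub, Matrix.smul_mul, Matrix.mul_smul,
      Matrix.mul_assoc, Matrix.mul_one, Matrix.one_mul]
    simp
  rw [hsymm, Matrix.mul_assoc, ← Matrix.conjTranspose_mul, reflection_mul_self,
    Matrix.conjTranspose_one, Matrix.mul_one]

theorem mul_reflection [DecidableEq ι] {γ : Type*} (A : Matrix γ ι ℂ) (F : Matrix ε ι ℂ) (Kx : Matrix ι ι ℂ) :
    A * reflection F Kx = (2 : ℂ) • (optGain A F Kx * F) - A := by
  simp [reflection, optGain, Matrix.mul_sub, Matrix.mul_assoc]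

/-- For singular Kx, F R = F can fail, but it holds on the range of the square root, which carries
the Gaussian law. With N = F Kx^{1/2} and M = N Nᴴ, M P M = M gives (M P - 1) N Nᴴ = 0, hence (M P -
1) N = 0. -/
theorem mul_reflection_mul_sqrt [DecidableEq ι] (F : Matrix ε ι ℂ) {Kx : Matrix ι ι ℂ} (hKx : Kx.PosSemidef) :
    F * reflection F Kx * CFC.sqrt Kx = F * CFC.sqrt Kx := by
  have h := (pinv_isMoorePenrose (F * Kx * Fᴴ)).mul_mul_self
  set M := F * Kx * Fᴴ
  set P := pinv M
  have hN : (F * CFC.sqrt Kx) * (F * CFC.sqrt Kx)ᴴ = M := by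
    rw [Matrix.conjTranspose_mul, Matrix.mul_assoc, ← Matrix.mul_assoc (CFC.sqrt Kx),
      sqrt_mul_conjTranspose_sqrt hKx, ← Matrix.mul_assoc]
  have hz : (M * P - 1) * (F * CFC.sqrt Kx) = 0 := by
    rw [← Matrix.self_mul_conjTranspose_eq_zero, Matrix.conjTranspose_mul, Matrix.mul_assoc,
      ← Matrix.mul_assoc _ _ ((M * P - 1)ᴴ), hN, ← Matrix.mul_assoc, Matrix.sub_mul, h,
      Matrix.one_mul, sub_self, Matrix.zero_mul]
  have hz' : M * P * (F * CFC.sqrt Kx) = F * CFC.sqrt Kx := by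
    rwa [Matrix.sub_mul, Matrix.one_mul, sub_eq_zero] at hz
  have hF : F * reflection F Kx = (2 : ℂ) • (M * P * F) - F := by
    simp [reflection, M, P, Matrix.mul_sub, Matrix.mul_assoc]
  rw [hF, Matrix.sub_mul, Matrix.smul_mul, Matrix.mul_assoc, hz', two_smul, add_sub_cancel_right]

end Matrices

/-! ### Moments of Gaussian laws -/

theorem memLp_stdComplexGaussian : MemLp (fun z : ℂ => z) 2 stdComplexGaussian :=
  IsGaussian.memLp_id stdComplexGaussian 2 (by simp)

theorem integral_stdComplexGaussian : ∫ z, z ∂stdComplexGaussian = 0 := by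
  have hi : Integrable (fun x : ℝ => (x : ℂ)) (gaussianReal 0 (1 / 2)) :=
    ((IsGaussian.memLp_id (gaussianReal 0 (1 / 2)) 1 (by simp)).integrable le_rfl).ofReal
  have h0 : ∫ x : ℝ, (x : ℂ) ∂gaussianReal 0 (1 / 2) = 0 := by
    rw [integral_complex_ofReal, integral_id_gaussianReal, Complex.ofReal_zero]
  have e : ∀ p : ℝ × ℝ, Complex.measurableEquivRealProd.symm p = p.1 + p.2 * Complex.I := by
    intro p
    apply Complex.ext <;> simp [Complex.measurableEquivRealProd]
  rw [stdComplexGaussian, integral_map_equiv]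
  simp_rw [e]
  rw [integral_add (hi.comp_fst _) ((hi.comp_snd _).mul_const _), integral_mul_const,
    integral_fun_fst (fun x : ℝ => (x : ℂ)), integral_fun_snd (fun x : ℝ => (x : ℂ)), h0]
  simp

theorem integral_mul_conj_stdComplexGaussian :
    ∫ z, z * (starRingEnd ℂ) z ∂stdComplexGaussian = 1 := by
  have hi : Integrable (fun x : ℝ => x ^ 2) (gaussianReal 0 (1 / 2)) :=
    (IsGaussian.memLp_id (gaussianReal 0 (1 / 2)) 2 (by simp)).integrable_sq
  have h0 : ∫ x : ℝ, x ^ 2 ∂gaussianReal 0 (1 / 2) = 1 / 2 := by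
    have h := variance_fun_id_gaussianReal (μ := 0) (v := 1 / 2)
    rw [variance_of_integral_eq_zero (by fun_prop) integral_id_gaussianReal] at h
    simpa using h
  have e : ∀ p : ℝ × ℝ, Complex.measurableEquivRealProd.symm p *
      (starRingEnd ℂ) (Complex.measurableEquivRealProd.symm p) = ((p.1 ^ 2 + p.2 ^ 2 : ℝ) : ℂ) := by
    intro p
    rw [Complex.mul_conj, Complex.normSq_apply]
    simp [Complex.measurableEquivRealProd, pow_two]
  rw [stdComplexGaussian, integral_map_equiv]
  simp_rw [e]
  rw [integral_complex_ofReal, integral_add (hi.comp_fst _) (hi.comp_snd _),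
    integral_fun_fst (fun x : ℝ => x ^ 2), integral_fun_snd (fun x : ℝ => x ^ 2), h0]
  norm_num

theorem memLp_stdVec (i : ι) : MemLp (fun w : ι → ℂ => w i) 2 (stdVec ι) :=
  memLp_stdComplexGaussian.comp_measurePreserving
    (measurePreserving_eval (fun _ : ι => stdComplexGaussian) i)

theorem integral_stdVec (i : ι) : ∫ w, w i ∂stdVec ι = 0 := by
  rw [stdVec, integral_comp_eval (X := fun _ => ℂ) (f := fun z : ℂ => z) (by fun_prop), integral_stdComplexGaussian]

theorem integral_mul_conj_stdVec [DecidableEq ι] (i j : ι) :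
    ∫ w, w i * (starRingEnd ℂ) (w j) ∂stdVec ι = if i = j then 1 else 0 := by
  split_ifs with h
  · subst h
    rw [stdVec, integral_comp_eval (X := fun _ => ℂ) (f := fun z : ℂ => z * (starRingEnd ℂ) z) (by fun_prop),
      integral_mul_conj_stdComplexGaussian]
  · have hind : iIndepFun (fun i (w : ι → ℂ) => w i) (stdVec ι) :=
      iIndepFun_pi (X := fun _ z => z) fun _ => by fun_prop
    have hij := (hind.indepFun h).comp (φ := fun z => z) (ψ := starRingEnd ℂ)
      (by fun_prop) (by fun_prop)
    have := hij.integral_fun_mul_eq_mul_integral (memLp_stdVec i).aestronglyMeasurable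
      (memLp_stdVec j).star.aestronglyMeasurable
    simp only [Function.comp] at this
    rw [this, integral_stdVec, zero_mul]

section Moments

variable [DecidableEq ι] (K : Matrix ι ι ℂ)

theorem memLp_complexGaussian : MemLp id 2 (complexGaussian K) := by
  refine (memLp_map_measure_iff (by fun_prop) (by fun_prop)).2 ?_
  refine memLp_pi_iff.2 fun i => ?_
  simp only [Function.comp, id, Matrix.mulVec, dotProduct]
  exact memLp_finsetSum _ fun k _ => (memLp_stdVec k).const_mul _

theorem integral_complexGaussian (i : ι) : ∫ x, x i ∂complexGaussian K = 0 := by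
  rw [complexGaussian, integral_map (by fun_prop)
    (by fun_prop : Measurable fun x : ι → ℂ => x i).aestronglyMeasurable]
  change ∫ w : ι → ℂ, ∑ k, CFC.sqrt K i k * w k ∂stdVec ι = 0
  rw [integral_finsetSum _ fun k _ => ((memLp_stdVec k).integrable one_le_two).const_mul _]
  simp [integral_const_mul, integral_stdVec]

theorem integral_mul_conj_complexGaussian (hK : K.PosSemidef) (i j : ι) :
    ∫ x, x i * (starRingEnd ℂ) (x j) ∂complexGaussian K = K i j := by
  rw [complexGaussian, integral_map (by fun_prop) (by fun_prop)]
  have e : ∀ w : ι → ℂ, (CFC.sqrt K *ᵥ w) i * (starRingEnd ℂ) ((CFC.sqrt K *ᵥ w) j) =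
      ∑ k, ∑ l, (CFC.sqrt K i k * (starRingEnd ℂ) (CFC.sqrt K j l)) *
        (w k * (starRingEnd ℂ) (w l)) := by
    intro w
    simp only [Matrix.mulVec, dotProduct, map_sum, map_mul, Finset.sum_mul_sum]
    exact Finset.sum_congr rfl fun k _ => Finset.sum_congr rfl fun l _ => by ring
  have hint : ∀ k l, Integrable (fun w : ι → ℂ => w k * (starRingEnd ℂ) (w l)) (stdVec ι) :=
    fun k l => (memLp_stdVec k).integrable_mul (memLp_stdVec l).star
  change ∫ w : ι → ℂ, _ ∂stdVec ι = _
  simp_rw [e]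
  rw [integral_finsetSum _ fun k _ => integrable_finsetSum _ fun l _ => (hint k l).const_mul _]
  simp_rw [integral_finsetSum _ fun l _ => (hint _ l).const_mul _, integral_const_mul,
    integral_mul_conj_stdVec]
  conv_rhs => rw [← sqrt_mul_conjTranspose_sqrt hK, Matrix.mul_apply]
  simp

theorem complexGaussian_mem_defenses (hK : K.PosSemidef) : complexGaussian K ∈ defenses K :=
  ⟨inferInstance, memLp_complexGaussian K, integral_mul_conj_complexGaussian K hK⟩

end Moments

theorem memLp_mulVec {p : Measure (ι → ℂ)} (hp : MemLp id 2 p) {γ : Type*}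
    (M : Matrix γ ι ℂ) (i : γ) :
    MemLp (fun x => (M *ᵥ x) i) 2 p := by
  simp only [Matrix.mulVec, dotProduct]
  exact memLp_finsetSum _ fun k _ => (memLp_pi_iff.1 hp k).const_mul _

theorem integrable_normSqSum_mulVec {p : Measure (ι → ℂ)} (hp : MemLp id 2 p)
    (M : Matrix β ι ℂ) : Integrable (fun x => normSqSum (M *ᵥ x)) p := by
  simp only [normSqSum]
  exact integrable_finsetSum _ fun i _ => (memLp_mulVec hp M i).integrable_norm_pow two_ne_zero

/-- This is why the payoff under the optimal attack depends on the input law only through Kx. -/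
theorem integral_normSqSum_mulVec {Kx : Matrix ι ι ℂ} {p : Measure (ι → ℂ)} (hp : p ∈ defenses Kx)
    (M : Matrix β ι ℂ) : ∫ x, normSqSum (M *ᵥ x) ∂p = ((M * Kx * Mᴴ).trace).re := by
  obtain ⟨_, hp2, hcov⟩ := hp
  have hm : ∀ k, MemLp (fun x : ι → ℂ => x k) 2 p := fun k => memLp_pi_iff.1 hp2 k
  have hint : ∀ k l, Integrable (fun x : ι → ℂ => x k * (starRingEnd ℂ) (x l)) p :=
    fun k l => (hm k).integrable_mul (hm l).star
  have e : ∀ x : ι → ℂ, ((normSqSum (M *ᵥ x) : ℝ) : ℂ) =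
      ∑ i, ∑ k, ∑ l, (M i k * (starRingEnd ℂ) (M i l)) * (x k * (starRingEnd ℂ) (x l)) := by
    intro x
    simp only [normSqSum, Complex.sq_norm, Complex.ofReal_sum, ← Complex.mul_conj, Matrix.mulVec,
      dotProduct, map_sum, map_mul, Finset.sum_mul_sum]
    exact Finset.sum_congr rfl fun i _ => Finset.sum_congr rfl fun k _ =>
      Finset.sum_congr rfl fun l _ => by ring
  rw [← Complex.ofReal_re (∫ x, normSqSum (M *ᵥ x) ∂p), ← integral_complex_ofReal]
  congr 1
  simp_rw [e]
  rw [integral_finsetSum _ fun i _ => integrable_finsetSum _ fun k _ =>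
    integrable_finsetSum _ fun l _ => (hint k l).const_mul _]
  simp_rw [integral_finsetSum _ fun k _ => integrable_finsetSum _ fun l _ =>
      (hint k l).const_mul _, integral_finsetSum _ fun l _ => (hint _ l).const_mul _,
    integral_const_mul, hcov]
  simp only [Matrix.trace, Matrix.diag, Matrix.mul_apply, Matrix.conjTranspose_apply,
    Finset.sum_mul]
  refine Finset.sum_congr rfl fun i _ => ?_
  rw [Finset.sum_comm]
  exact Finset.sum_congr rfl fun l _ => Finset.sum_congr rfl fun k _ => by
    simp only [starRingEnd_apply]; ring

end Spoofing

end

noncomputable section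

namespace Spoofing

variable {ι β ε : Type*} [Fintype ι] [Fintype β] [Fintype ε]

/-! ### Divergences between Gaussian channels -/

theorem normSqSum_sub (w e : β → ℂ) :
    normSqSum (w - e) = normSqSum w + normSqSum e - 2 * ∑ i, ((starRingEnd ℂ) (e i) * w i).re := by
  simp only [normSqSum, Finset.mul_sum, ← Finset.sum_add_distrib, ← Finset.sum_sub_distrib]
  refine Finset.sum_congr rfl fun i _ => ?_
  simp only [Complex.sq_norm, Complex.normSq_apply, Pi.sub_apply, Complex.sub_re, Complex.sub_im,
    Complex.mul_re, Complex.conj_re, Complex.conj_im]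
  ring

theorem normSqSum_add_add_sub (u e : β → ℂ) :
    normSqSum (u - e) + normSqSum (u + e) = 2 * normSqSum u + 2 * normSqSum e := by
  simp only [normSqSum, Finset.mul_sum, ← Finset.sum_add_distrib]
  refine Finset.sum_congr rfl fun i _ => ?_
  simp only [Complex.sq_norm, Complex.normSq_apply, Pi.sub_apply, Pi.add_apply, Complex.sub_re,
    Complex.sub_im, Complex.add_re, Complex.add_im]
  ring

section Channels

variable [DecidableEq β] {p : Measure (ι → ℂ)} [IsProbabilityMeasure p] (hp : MemLp id 2 p)
include hp

/-- The noise is centred and independent of the input, so the input itself need not be centred. -/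
theorem integrable_and_integral_cross_term (D : Matrix β ι ℂ) (K : Matrix β β ℂ) (i : β) :
    Integrable (fun q : (ι → ℂ) × (β → ℂ) => ((starRingEnd ℂ) ((D *ᵥ q.1) i) * q.2 i).re)
        (p.prod (complexGaussian K)) ∧
      ∫ q : (ι → ℂ) × (β → ℂ), ((starRingEnd ℂ) ((D *ᵥ q.1) i) * q.2 i).re
        ∂(p.prod (complexGaussian K)) = 0 := by
  have h1 : Integrable (fun x => (starRingEnd ℂ) ((D *ᵥ x) i)) p :=
    (memLp_mulVec hp D i).star.integrable one_le_two
  have h2 : Integrable (fun w : β → ℂ => w i) (complexGaussian K) :=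
    (memLp_pi_iff.1 (memLp_complexGaussian K) i).integrable one_le_two
  have h := h1.mul_prod h2
  refine ⟨h.re, ?_⟩
  have hre := integral_re h
  simp only [RCLike.re_eq_complex_re] at hre
  rw [hre, integral_prod_mul (fun x => (starRingEnd ℂ) ((D *ᵥ x) i)) (fun w : β → ℂ => w i),
    integral_complexGaussian, mul_zero, Complex.zero_re]

theorem integrable_and_integral_channelLogDensity (A B : Matrix β ι ℂ) (σ : ℝ)
    (K : Matrix β β ℂ) :
    Integrable (fun q => -channelLogDensity A B σ q.1 q.2) (p ⊗ₘ gaussianChannel B K) ∧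
      ∫ q, -channelLogDensity A B σ q.1 q.2 ∂(p ⊗ₘ gaussianChannel B K) =
        (∫ x, normSqSum ((A - B) *ᵥ x) ∂p) / σ ^ 2 := by
  have hm : Measurable fun q : (ι → ℂ) × (β → ℂ) => -channelLogDensity A B σ q.1 q.2 :=
    (measurable_channelLogDensity A B σ).neg
  have hT : Measurable fun q : (ι → ℂ) × (β → ℂ) => (q.1, B *ᵥ q.1 + q.2) := by fun_prop
  have e : ∀ q : (ι → ℂ) × (β → ℂ), -channelLogDensity A B σ q.1 (B *ᵥ q.1 + q.2) =
      (normSqSum ((A - B) *ᵥ q.1) -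
        2 * ∑ i, ((starRingEnd ℂ) (((A - B) *ᵥ q.1) i) * q.2 i).re) / σ ^ 2 := by
    intro q
    have h : B *ᵥ q.1 + q.2 - A *ᵥ q.1 = q.2 - (A - B) *ᵥ q.1 := by
      rw [Matrix.sub_mulVec]; abel
    rw [channelLogDensity, h, add_sub_cancel_left, normSqSum_sub]
    ring
  have h1 : Integrable (fun q : (ι → ℂ) × (β → ℂ) => normSqSum ((A - B) *ᵥ q.1))
      (p.prod (complexGaussian K)) := (integrable_normSqSum_mulVec hp (A - B)).comp_fst _
  have h2 : Integrable (fun q : (ι → ℂ) × (β → ℂ) =>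
      2 * ∑ i, ((starRingEnd ℂ) (((A - B) *ᵥ q.1) i) * q.2 i).re)
      (p.prod (complexGaussian K)) :=
    (integrable_finsetSum _ fun i _ =>
      (integrable_and_integral_cross_term hp (A - B) K i).1).const_mul 2
  rw [compProd_gaussianChannel, integrable_map_measure hm.aestronglyMeasurable hT.aemeasurable,
    integral_map hT.aemeasurable hm.aestronglyMeasurable]
  simp only [Function.comp_def, e]
  refine ⟨(h1.sub h2).div_const _, ?_⟩
  rw [integral_div, integral_sub h1 h2, integral_const_mul, integral_finsetSum _ fun i _ =>
      (integrable_and_integral_cross_term hp (A - B) K i).1,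
    integral_fun_fst (fun x => normSqSum ((A - B) *ᵥ x)), Finset.sum_eq_zero fun i _ =>
      (integrable_and_integral_cross_term hp (A - B) K i).2]
  simp

/-- The divergence between two white Gaussian channels driven by the same input. -/
theorem klDiv_compProd_gaussianChannel (A B : Matrix β ι ℂ) {σ : ℝ} (hσ : 0 < σ) :
    klDiv (p ⊗ₘ gaussianChannel B (whiteCov β σ)) (p ⊗ₘ gaussianChannel A (whiteCov β σ)) =
      ENNReal.ofReal ((∫ x, normSqSum ((A - B) *ᵥ x) ∂p) / σ ^ 2) := by
  obtain ⟨hint, hval⟩ :=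
    integrable_and_integral_channelLogDensity hp A B σ (whiteCov β σ)
  have hm : Measurable fun q : (ι → ℂ) × (β → ℂ) => channelLogDensity A B σ q.1 q.2 :=
    measurable_channelLogDensity A B σ
  have hd := compProd_gaussianChannel_withDensity p A B hσ
  set μ := p ⊗ₘ gaussianChannel B (whiteCov β σ)
  have hac : μ ≪ p ⊗ₘ gaussianChannel A (whiteCov β σ) :=
    hd ▸ absolutelyContinuous_withDensity_exp μ hm
  have hllr : llr μ (p ⊗ₘ gaussianChannel A (whiteCov β σ)) =ᵐ[μ]
      fun q => -channelLogDensity A B σ q.1 q.2 := by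
    rw [hd]
    filter_upwards [llr_withDensity_exp (Measure.AbsolutelyContinuous.refl μ) hm, llr_self μ]
      with q h1 h2
    rw [h1, h2, Pi.zero_apply, zero_sub]
  rw [klDiv_of_ac_of_integrable hac ((integrable_congr hllr).2 hint), integral_congr_ae hllr, hval]
  simp

/-- If the mean `A x` can be replaced by its mirror image `A' x` with respect to `G x` without
increasing the divergence from `μ`, then this divergence is at least the one attained by the
channel `x ↦ N(G x, σ² I)`. -/
theorem le_klDiv_of_klDiv_mirror_le {A A' G : Matrix β ι ℂ} (hG : A' = (2 : ℂ) • G - A) {σ : ℝ}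
    (hσ : 0 < σ) {μ : Measure ((ι → ℂ) × (β → ℂ))} [IsProbabilityMeasure μ]
    (hfst : μ.map Prod.fst = p)
    (hle : klDiv μ (p ⊗ₘ gaussianChannel A' (whiteCov β σ)) ≤
      klDiv μ (p ⊗ₘ gaussianChannel A (whiteCov β σ))) :
    ENNReal.ofReal ((∫ x, normSqSum ((A - G) *ᵥ x) ∂p) / σ ^ 2) ≤
      klDiv μ (p ⊗ₘ gaussianChannel A (whiteCov β σ)) := by
  by_cases htop : klDiv μ (p ⊗ₘ gaussianChannel A (whiteCov β σ)) = ∞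
  · simp [htop]
  have htop' := ne_top_of_le_ne_top htop hle
  obtain ⟨hac, hint⟩ := klDiv_ne_top_iff.1 htop
  obtain ⟨hac', hint'⟩ := klDiv_ne_top_iff.1 htop'
  have hr := (ENNReal.toReal_le_toReal htop' htop).2 hle
  -- White channels with the same σ > 0 have positive densities with respect to each other.
  have hacG : μ ≪ p ⊗ₘ gaussianChannel G (whiteCov β σ) := by
    refine hac.trans ?_
    rw [compProd_gaussianChannel_withDensity p A G hσ]
    exact withDensity_absolutelyContinuous _ _
  have hgap : Integrable (fun q : (ι → ℂ) × (β → ℂ) => normSqSum ((A - G) *ᵥ q.1) / σ ^ 2) μ :=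
    ((hfst ▸ integrable_normSqSum_mulVec hp (A - G) :
      Integrable _ (μ.map Prod.fst)).comp_measurable measurable_fst).div_const _
  have hgap_int : ∫ q, normSqSum ((A - G) *ᵥ q.1) / σ ^ 2 ∂μ =
      (∫ x, normSqSum ((A - G) *ᵥ x) ∂p) / σ ^ 2 := by
    rw [integral_div, ← hfst, integral_map (by fun_prop)
      (by fun_prop : Measurable fun x => normSqSum ((A - G) *ᵥ x)).aestronglyMeasurable]
  -- The means of A and A' are G x ± (A - G) x, so the parallelogram law applies to v - G x and (A -
  -- G) x.
  have hsum : (fun q => llr μ (p ⊗ₘ gaussianChannel A (whiteCov β σ)) q +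
      llr μ (p ⊗ₘ gaussianChannel A' (whiteCov β σ)) q) =ᵐ[μ]
      fun q => 2 * llr μ (p ⊗ₘ gaussianChannel G (whiteCov β σ)) q +
        2 * (normSqSum ((A - G) *ᵥ q.1) / σ ^ 2) := by
    have hm : ∀ D : Matrix β ι ℂ, Measurable fun q : (ι → ℂ) × (β → ℂ) =>
        channelLogDensity D G σ q.1 q.2 := fun D => measurable_channelLogDensity D G σ
    have h1 := llr_withDensity_exp hacG (hm A)
    have h2 := llr_withDensity_exp hacG (hm A')
    rw [← compProd_gaussianChannel_withDensity p _ G hσ] at h1 h2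
    filter_upwards [h1, h2] with q e1 e2
    have hpar := normSqSum_add_add_sub (q.2 - G *ᵥ q.1) ((A - G) *ᵥ q.1)
    have ea : q.2 - G *ᵥ q.1 - (A - G) *ᵥ q.1 = q.2 - A *ᵥ q.1 := by
      rw [Matrix.sub_mulVec]; abel
    have eb : q.2 - G *ᵥ q.1 + (A - G) *ᵥ q.1 = q.2 - A' *ᵥ q.1 := by
      rw [hG, Matrix.sub_mulVec, Matrix.sub_mulVec, Matrix.smul_mulVec, two_smul]; abel
    rw [ea, eb] at hpar
    rw [e1, e2, channelLogDensity, channelLogDensity]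
    linear_combination hpar / σ ^ 2
  -- Integrability for the middle channel is obtained by solving the identity for its log-likelihood
  -- ratio.
  have hintG : Integrable (llr μ (p ⊗ₘ gaussianChannel G (whiteCov β σ))) μ := by
    have h := (((integrable_congr hsum).1 (hint.add hint')).sub (hgap.const_mul 2)).const_mul (1 / 2)
    refine h.congr (Filter.Eventually.of_forall fun q => ?_)
    simp only [Pi.sub_apply]
    ring
  have hval := integral_congr_ae hsum
  rw [integral_add hint hint', integral_add (hintG.const_mul 2) (hgap.const_mul 2),
    integral_const_mul, integral_const_mul, hgap_int,
    ← toReal_klDiv_of_measure_eq hac (by simp), ← toReal_klDiv_of_measure_eq hac' (by simp),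
    ← toReal_klDiv_of_measure_eq hacG (by simp)] at hval
  rw [← ENNReal.ofReal_toReal htop]
  refine ENNReal.ofReal_le_ofReal ?_
  -- Dropping the nonnegative middle divergence and bounding the mirrored one by the original leaves
  -- twice the claim.
  have := ENNReal.toReal_nonneg (a := klDiv μ (p ⊗ₘ gaussianChannel G (whiteCov β σ)))
  linarith

end Channels

/-- Relabelling the input by a measure-preserving T turns κ into η; agreement is needed only almost
everywhere, as F R x = F x is an a.e. statement. -/
theorem map_compProd_of_ae_eq {α γ : Type*} {mα : MeasurableSpace α} {mγ : MeasurableSpace γ}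
    {p : Measure α} [IsProbabilityMeasure p] {κ η : Kernel α γ} [IsMarkovKernel κ]
    [IsMarkovKernel η] {T : α → α} (hT : Measurable T) (hp : p.map T = p)
    (h : ∀ᵐ x ∂p, κ x = η (T x)) : (p ⊗ₘ κ).map (Prod.map T id) = p ⊗ₘ η := by
  have hTm : Measurable (Prod.map T (id : γ → γ)) := hT.prodMap measurable_id
  ext s hs
  rw [Measure.map_apply hTm hs, Measure.compProd_apply (hTm hs), Measure.compProd_apply hs]
  conv_rhs => rw [← hp]
  rw [lintegral_map (Kernel.measurable_kernel_prodMk_left hs) hT]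
  refine lintegral_congr_ae ?_
  filter_upwards [h] with x hx
  rw [hx]
  rfl

/-! ### The saddle point -/

section Game

variable [DecidableEq β] [DecidableEq ε] (A : Matrix β ι ℂ) (F : Matrix ε ι ℂ) {Kx : Matrix ι ι ℂ}
  (hKx : Kx.PosSemidef) {σB σE σB' : ℝ} (hσB : 0 < σB) {C : Matrix β β ℂ}
  (hC : C * Cᴴ = optNoiseCov A F Kx σB σE σB')

include hKx in
-- R Kx^{1/2} is another factor of Kx.
theorem map_reflection_complexGaussian [DecidableEq ι] :
    (complexGaussian Kx).map (fun x => reflection F Kx *ᵥ x) = complexGaussian Kx := by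
  have h : reflection F Kx * CFC.sqrt Kx * (reflection F Kx * CFC.sqrt Kx)ᴴ = Kx := by
    rw [Matrix.conjTranspose_mul, Matrix.mul_assoc, ← Matrix.mul_assoc (CFC.sqrt Kx),
      sqrt_mul_conjTranspose_sqrt hKx, ← Matrix.mul_assoc, reflection_conj F hKx]
  refine Eq.trans ?_ (complexGaussian_eq_map_stdVec h).symm
  rw [complexGaussian, Measure.map_map (by fun_prop) (by fun_prop)]
  congr 1
  ext1 w
  simp [Function.comp]

include hKx in
theorem ae_mulVec_reflection_eq [DecidableEq ι] :
    ∀ᵐ x ∂complexGaussian Kx, F *ᵥ (reflection F Kx *ᵥ x) = F *ᵥ x := by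
  have hm : MeasurableSet {x : ι → ℂ | F *ᵥ (reflection F Kx *ᵥ x) = F *ᵥ x} :=
    measurableSet_eq_fun (by fun_prop) (by fun_prop)
  rw [complexGaussian, ae_map_iff (by fun_prop) hm]
  refine Filter.Eventually.of_forall fun w => ?_
  rw [Matrix.mulVec_mulVec, Matrix.mulVec_mulVec, Matrix.mulVec_mulVec, mul_reflection_mul_sqrt F hKx]

include hKx hσB hC in
theorem payoff_optAttack {p : Measure (ι → ℂ)} (hp : p ∈ defenses Kx) :
    payoff A F σB σE p (optAttack A F Kx σB' C) =
      ENNReal.ofReal ((((A - optGain A F Kx * F) * Kx * (A - optGain A F Kx * F)ᴴ).trace).re /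
        σB ^ 2) := by
  have := hp.1
  rw [payoff, optAttack, gaussianChannel_comp F (optGain A F Kx) (posSemidef_whiteCov σE)
    ((Matrix.posSemidef_self_mul_conjTranspose C).add (posSemidef_whiteCov σB'))
    (optGain_noise_add A F hKx hC), klDiv_compProd_gaussianChannel hp.2.1 _ _ hσB,
    integral_normSqSum_mulVec hp]

include hKx hσB in
theorem le_payoff_complexGaussian [DecidableEq ι] (q : Kernel (ε → ℂ) (β → ℂ)) [IsMarkovKernel q] :
    ENNReal.ofReal ((((A - optGain A F Kx * F) * Kx * (A - optGain A F Kx * F)ᴴ).trace).re /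
        σB ^ 2) ≤ payoff A F σB σE (complexGaussian Kx) q := by
  have hmap := map_reflection_complexGaussian F hKx
  have hT : Measurable fun x : ι → ℂ => reflection F Kx *ᵥ x := by fun_prop
  -- The attack's output law depends on x only through F x, which the reflection fixes.
  have hattack : (complexGaussian Kx ⊗ₘ (q ∘ₖ gaussianChannel F (whiteCov ε σE))).map
      (Prod.map (fun x => reflection F Kx *ᵥ x) id) =
      complexGaussian Kx ⊗ₘ (q ∘ₖ gaussianChannel F (whiteCov ε σE)) := by
    refine map_compProd_of_ae_eq hT hmap ?_
    filter_upwards [ae_mulVec_reflection_eq F hKx] with x hx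
    rw [Kernel.comp_apply, Kernel.comp_apply, gaussianChannel_apply, gaussianChannel_apply, hx]
  -- Since R is an involution, A x = (A R)(R x): the reflected input sees the gain A R.
  have hchannel : (complexGaussian Kx ⊗ₘ gaussianChannel A (whiteCov β σB)).map
      (Prod.map (fun x => reflection F Kx *ᵥ x) id) =
      complexGaussian Kx ⊗ₘ gaussianChannel (A * reflection F Kx) (whiteCov β σB) := by
    refine map_compProd_of_ae_eq hT hmap (Filter.Eventually.of_forall fun x => ?_)
    rw [gaussianChannel_apply, gaussianChannel_apply, Matrix.mulVec_mulVec, Matrix.mul_assoc,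
      reflection_mul_self, Matrix.mul_one]
  -- Data processing under the reflection supplies the mirror inequality.
  have hle := klDiv_map_le (complexGaussian Kx ⊗ₘ (q ∘ₖ gaussianChannel F (whiteCov ε σE)))
    (complexGaussian Kx ⊗ₘ gaussianChannel A (whiteCov β σB)) (hT.prodMap measurable_id)
  rw [hattack, hchannel] at hle
  rw [payoff, ← integral_normSqSum_mulVec (complexGaussian_mem_defenses Kx hKx)]
  exact le_klDiv_of_klDiv_mirror_le (memLp_complexGaussian Kx) (mul_reflection A F Kx) hσB
    (Measure.fst_compProd _ _) hle

end Game

end Spoofing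

end

theorem theorem2 {ι β ε : Type*} [Fintype ι] [Fintype β] [Fintype ε]
    [DecidableEq ι] [DecidableEq β] [DecidableEq ε]
    (A : Matrix β ι ℂ) (F : Matrix ε ι ℂ) (Kx : Matrix ι ι ℂ) (hKx : Kx.PosSemidef)
    (σB σE σB' : ℝ) (hσB : 0 < σB) (hσE : 0 ≤ σE) (hσB' : 0 ≤ σB')
    (C : Matrix β β ℂ) (hC : C * Cᴴ = Spoofing.optNoiseCov A F Kx σB σE σB') :
    Spoofing.complexGaussian Kx ∈ Spoofing.defenses Kx ∧
    Spoofing.optAttack A F Kx σB' C ∈ Spoofing.attacks β ε ∧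
    Spoofing.payoff A F σB σE (Spoofing.complexGaussian Kx)
      (Spoofing.optAttack A F Kx σB' C) ≠ ∞ ∧
    IsSaddlePointOn (Spoofing.attacks β ε) (Spoofing.defenses Kx)
      (fun q px => Spoofing.payoff A F σB σE px q)
      (Spoofing.optAttack A F Kx σB' C) (Spoofing.complexGaussian Kx) ∧
    (∀ px ∈ Spoofing.defenses Kx,
      Spoofing.payoff A F σB σE px (Spoofing.optAttack A F Kx σB' C) =
        Spoofing.payoff A F σB σE (Spoofing.complexGaussian Kx)
          (Spoofing.optAttack A F Kx σB' C)) ∧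
    (∀ q ∈ Spoofing.attacks β ε,
      Spoofing.payoff A F σB σE (Spoofing.complexGaussian Kx)
          (Spoofing.optAttack A F Kx σB' C) ≤
        Spoofing.payoff A F σB σE (Spoofing.complexGaussian Kx) q) := by
  have hG := Spoofing.complexGaussian_mem_defenses Kx hKx
  have hA : Spoofing.optAttack A F Kx σB' C ∈ Spoofing.attacks β ε := by
    change IsMarkovKernel (Spoofing.gaussianChannel _ _)
    infer_instance
  have hval := fun px (hpx : px ∈ Spoofing.defenses Kx) =>
    Spoofing.payoff_optAttack A F hKx hσB hC hpx
  have hlow : ∀ q ∈ Spoofing.attacks β ε,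
      Spoofing.payoff A F σB σE (Spoofing.complexGaussian Kx) (Spoofing.optAttack A F Kx σB' C) ≤
        Spoofing.payoff A F σB σE (Spoofing.complexGaussian Kx) q := by
    intro q hq
    have : IsMarkovKernel q := hq
    rw [hval _ hG]
    exact Spoofing.le_payoff_complexGaussian A F hKx hσB q
  refine ⟨hG, hA, ?_, ?_, ?_, hlow⟩
  · rw [hval _ hG]
    exact ENNReal.ofReal_ne_top
  · intro q hq px hpx
    change Spoofing.payoff A F σB σE px _ ≤ _
    rw [hval px hpx, ← hval _ hG]
    exact hlow q hq
  · intro px hpx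
    rw [hval px hpx, hval _ hG]
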